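/- For a finite group $G$ let $L(G)$ be the set of its subgroups and $L_1(G)$ the set of its cyclic subgroups, and put $$sd(G)=\frac{|\{(H,K)\in L(G)^2 : HK=KH\}|}{|L(G)|^2},\qquad csd(G)=\frac{|\{(H,K)\in L_1(G)^2 : HK=KH\}|}{|L_1(G)|^2}.$$ For $m,n,r\in\mathbb{N}$ with $\gcd(m,n)=\gcd(m,r-1)=1$ and $r^n\equiv 1 \pmod m$ let $$ZM(m,n,r)=\langle a,b \mid a^m=b^n=1,\ b^{-1}ab=a^r\rangle .$$ Let $\tau(m)$ and $\sigma(m)$ be the number and the sum of the positive divisors of $m$, and let $g(m)=m\sum_{u\mid m}\sum_{v\mid m}\frac{1}{\gcd(u,v)}$. **Proposition 4.5.** Let $n$ be a prime number and let $m,r$ be such that $(m,n,r)$ satisfies the conditions above. Then (i) $$sd(ZM(m,n,r))=\frac{\tau(m)^2+2\tau(m)\sigma(m)+g(m)}{(\tau(m)+\sigma(m))^2},$$ (ii) $$csd(ZM(m,n,r))=\frac{\tau(m)(\tau(m)+m)+m(\tau(m)+1)}{(\tau(m)+m)^2}.$$ In particular both values depend only on $m$: if $(m,n',r')$ also satisfies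 the conditions and $n'$ is prime, then $sd(ZM(m,n,r))=sd(ZM(m,n',r'))$ and $csd(ZM(m,n,r))=csd(ZM(m,n',r'))$. Moreover, for every odd $m\ge 3$ the triple $(m,2,m-1)$ satisfies the conditions, $ZM(m,2,m-1)$ is isomorphic to the dihedral group $D_{2m}$ of order $2m$, hence $sd(ZM(m,2,m-1))=sd(D_{2m})$ and $csd(ZM(m,2,m-1))=csd(D_{2m})$, and these are given by the right-hand sides of (i) and (ii). -/

import Mathlib

open scoped Pointwise

/-- The subgroup commutativity degree of a finite group `G`: the proportion of pairs `(H, K)` of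
subgroups of `G` with `HK = KH`, where `HK = {hk | h ∈ H, k ∈ K}`. -/
noncomputable def sd (G : Type*) [Group G] : ℚ :=
  (Nat.card {p : Subgroup G × Subgroup G //
      (p.1 : Set G) * (p.2 : Set G) = (p.2 : Set G) * (p.1 : Set G)} : ℚ) /
    (Nat.card (Subgroup G) : ℚ) ^ 2

/-- The poset of cyclic subgroups of `G`. -/
abbrev CyclicSubgroup (G : Type*) [Group G] : Type _ := {H : Subgroup G // IsCyclic H}

/-- The cyclic subgroup commutativity degree of a finite group `G`: the proportion of pairs
`(H, K)` of cyclic subgroups of `G` with `HK = KH`. -/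
noncomputable def csd (G : Type*) [Group G] : ℚ :=
  (Nat.card {p : CyclicSubgroup G × CyclicSubgroup G //
      (p.1.1 : Set G) * (p.2.1 : Set G) = (p.2.1 : Set G) * (p.1.1 : Set G)} : ℚ) /
    (Nat.card (CyclicSubgroup G) : ℚ) ^ 2

/-- The two generators `a`, `b` of a ZM-group. -/
inductive ZMGen : Type
  | a
  | b

/-- The relators of `⟨a, b | a ^ m = b ^ n = 1, b⁻¹ a b = a ^ r⟩`. -/
def zmRelators (m n r : ℕ) : Set (FreeGroup ZMGen) :=
  {FreeGroup.of ZMGen.a ^ m,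
   FreeGroup.of ZMGen.b ^ n,
   (FreeGroup.of ZMGen.b)⁻¹ * FreeGroup.of ZMGen.a * FreeGroup.of ZMGen.b *
     (FreeGroup.of ZMGen.a ^ r)⁻¹}

/-- The group `ZM(m, n, r) = ⟨a, b | a ^ m = b ^ n = 1, b⁻¹ a b = a ^ r⟩`. -/
abbrev ZM (m n r : ℕ) : Type := PresentedGroup (zmRelators m n r)

/-- The conditions on the parameters of a ZM-group: `(m, n) = (m, r - 1) = 1` and
`r ^ n ≡ 1 (mod m)`. The difference `r - 1` is taken in `ℤ`. -/
structure IsZMTriple (m n r : ℕ) : Prop where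
  coprime : Nat.gcd m n = 1
  coprime_sub_one : Int.gcd (m : ℤ) ((r : ℤ) - 1) = 1
  pow_modEq : r ^ n ≡ 1 [MOD m]

/-- `τ(m)`, the number of positive divisors of `m`, as a rational number. -/
def tauQ (m : ℕ) : ℚ := (ArithmeticFunction.sigma 0 m : ℚ)

/-- `σ(m)`, the sum of the positive divisors of `m`, as a rational number. -/
def sigmaQ (m : ℕ) : ℚ := (ArithmeticFunction.sigma 1 m : ℚ)

/-- `g(m) = m ∑_{u, v ∣ m} 1 / (u, v)`. -/
def gcdSum (m : ℕ) : ℚ :=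
  (m : ℚ) * ∑ u ∈ m.divisors, ∑ v ∈ m.divisors, 1 / (Nat.gcd u v : ℚ)

/-- The value `(τ(m)² + 2τ(m)σ(m) + g(m)) / (τ(m) + σ(m))²`. -/
def sdValue (m : ℕ) : ℚ :=
  (tauQ m ^ 2 + 2 * tauQ m * sigmaQ m + gcdSum m) / (tauQ m + sigmaQ m) ^ 2

/-- The value `(τ(m)(τ(m) + m) + m(τ(m) + 1)) / (τ(m) + m)²`. -/
def csdValue (m : ℕ) : ℚ :=
  (tauQ m * (tauQ m + m) + m * (tauQ m + 1)) / (tauQ m + m) ^ 2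

/-! The group acts on `ZMod m` by affine maps: `a` is `x ↦ x + 1` and `b` is multiplication by the
inverse of `r`. Since `n` is prime and `r - 1` is a unit mod `m`, every element outside `⟨a⟩` has a
ratio `c` with `c - 1` a unit, so it fixes exactly one class modulo each divisor of `m`.
`AffineData` records just this.

A subgroup meets the translations in the multiples of some `u ∣ m`. Either it consists of
translations, or it contains an element with a fixed point `x`, whose image generates the quotient
of prime order; it is then the stabiliser of `x` mod `u` (`eq_transSubgroup_or_eq_stab`). This gives
`τ(m) + σ(m)` subgroups. The cyclic ones are the `τ(m)` translation groups and the `m` point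
stabilisers (`isCyclic_stab_iff`).

Translation groups are normal, hence permute with everything. The stabilisers of `x` mod `u` and `y`
mod `v` permute iff `x ≡ y` mod `gcd(u, v)` (`stab_mul_comm_iff`). By the Chinese remainder theorem
there are `lcm(u, v)` such pairs of classes, and passing to complementary divisors turns the sum of
these into `g(m)`. -/

theorem ZMod.natCast_dvd_intCast_iff {m u : ℕ} (hu : u ∣ m) (k : ℤ) :
    (u : ZMod m) ∣ (k : ZMod m) ↔ (u : ℤ) ∣ k := by
  constructor
  · rintro ⟨c, hc⟩
    obtain ⟨c, rfl⟩ := ZMod.intCast_surjective c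
    have h : ((k - u * c : ℤ) : ZMod m) = 0 := by push_cast; rw [hc]; ring
    rw [ZMod.intCast_zmod_eq_zero_iff_dvd] at h
    have h' : (u : ℤ) ∣ k - u * c := (Int.natCast_dvd_natCast.2 hu).trans h
    simpa using dvd_add h' (dvd_mul_right (u : ℤ) c)
  · rintro ⟨c, rfl⟩
    exact ⟨c, by push_cast; ring⟩

/-! ### Affine groups over `ZMod m` and the classification of their subgroups. -/

/-- A realisation of a group as the semidirect product of `ZMod m` by `ZMod n`, the latter acting
by homotheties whose nontrivial members have no nonzero fixed vector modulo any divisor of `m`: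
the element `g` is thought of as the affine map `x ↦ mult g * x + trans g` of `ZMod m`. -/
structure AffineData (G : Type*) [Group G] (m n : ℕ) where
  /-- The translation part. -/
  trans : G → ZMod m
  /-- The ratio of the linear part. -/
  mult : G →* (ZMod m)ˣ
  /-- The projection to the complement. -/
  proj : G →* Multiplicative (ZMod n)
  trans_mul : ∀ g h, trans (g * h) = trans g + mult g * trans h
  bijective : Function.Bijective fun g => (trans g, proj g)
  mult_eq_one : ∀ g, proj g = 1 → mult g = 1
  isUnit_mult_sub_one : ∀ g, proj g ≠ 1 → IsUnit ((mult g : ZMod m) - 1)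

namespace AffineData

variable {G : Type*} [Group G] {m n : ℕ} (D : AffineData G m n)

theorem trans_one : D.trans 1 = 0 := by
  have h := D.trans_mul 1 1
  simpa using h

theorem trans_inv (g : G) : D.trans g⁻¹ = -((D.mult g⁻¹ : (ZMod m)ˣ) * D.trans g) := by
  have h := D.trans_mul g⁻¹ g
  rw [inv_mul_cancel, D.trans_one] at h
  exact eq_neg_of_add_eq_zero_left h.symm

theorem ext {g h : G} (ht : D.trans g = D.trans h) (hp : D.proj g = D.proj h) : g = h :=
  D.bijective.1 (Prod.ext ht hp)

theorem exists_eq (x : ZMod m) (c : Multiplicative (ZMod n)) :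
    ∃ g, D.trans g = x ∧ D.proj g = c := by
  obtain ⟨g, hg⟩ := D.bijective.2 (x, c)
  exact ⟨g, congrArg Prod.fst hg, congrArg Prod.snd hg⟩

theorem mult_congr {g h : G} (hp : D.proj g = D.proj h) : D.mult g = D.mult h := by
  have := D.mult_eq_one (g * h⁻¹) (by simp [hp])
  rwa [map_mul, map_inv, mul_inv_eq_one] at this

/-- The group of translations by the multiples of `u`. -/
def transSubgroup (u : ℕ) : Subgroup G where
  carrier := {g | D.proj g = 1 ∧ (u : ZMod m) ∣ D.trans g}
  one_mem' := by simp [D.trans_one]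
  mul_mem' := by
    rintro a b ⟨ha, ha'⟩ ⟨hb, hb'⟩
    exact ⟨by simp [ha, hb], by rw [D.trans_mul]; exact dvd_add ha' (hb'.mul_left _)⟩
  inv_mem' := by
    rintro a ⟨ha, ha'⟩
    exact ⟨by simp [ha], by rw [D.trans_inv]; exact (ha'.mul_left _).neg_right⟩

/-- The stabiliser of the residue class of `x` modulo `u`. -/
def stab (u : ℕ) (x : ZMod m) : Subgroup G where
  carrier := {g | (u : ZMod m) ∣ D.trans g + (D.mult g - 1) * x}
  one_mem' := by simp [D.trans_one]
  mul_mem' := by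
    intro a b ha hb
    have := dvd_add ha (hb.mul_left (D.mult a : ZMod m))
    simp only [Set.mem_ofPred_eq, D.trans_mul, map_mul, Units.val_mul]
    convert this using 1
    ring
  inv_mem' := by
    intro a ha
    have := (ha.mul_left (D.mult a⁻¹ : (ZMod m)ˣ)).neg_right
    have h : ((D.mult a⁻¹ : (ZMod m)ˣ) : ZMod m) * D.mult a = 1 := by
      rw [← Units.val_mul, ← map_mul]; simp
    simp only [Set.mem_ofPred_eq, D.trans_inv]
    convert this using 1
    linear_combination x * h

theorem mem_transSubgroup {u : ℕ} {g : G} :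
    g ∈ D.transSubgroup u ↔ D.proj g = 1 ∧ (u : ZMod m) ∣ D.trans g := Iff.rfl

theorem mem_stab {u : ℕ} {x : ZMod m} {g : G} :
    g ∈ D.stab u x ↔ (u : ZMod m) ∣ D.trans g + (D.mult g - 1) * x := Iff.rfl

theorem mem_stab_of_proj_eq_one {u : ℕ} {x : ZMod m} {g : G} (hg : D.proj g = 1) :
    g ∈ D.stab u x ↔ (u : ZMod m) ∣ D.trans g := by
  simp [mem_stab, D.mult_eq_one g hg]

theorem exists_fixing (x : ZMod m) (c : Multiplicative (ZMod n)) :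
    ∃ g, D.proj g = c ∧ ∀ u, g ∈ D.stab u x := by
  -- `g₀` only serves to name the ratio attached to `c`, which depends on the projection alone.
  obtain ⟨g₀, -, h₀⟩ := D.exists_eq 0 c
  obtain ⟨g, ht, hp⟩ := D.exists_eq (-((D.mult g₀ - 1) * x)) c
  refine ⟨g, hp, fun u => ?_⟩
  rw [mem_stab, ht, D.mult_congr (hp.trans h₀.symm)]
  simp

theorem exists_fixed {g : G} (hg : D.proj g ≠ 1) : ∃ x, ∀ u, g ∈ D.stab u x := by
  obtain ⟨c, hc⟩ := (D.isUnit_mult_sub_one g hg).exists_right_inv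
  refine ⟨-(c * D.trans g), fun u => ?_⟩
  rw [mem_stab]
  convert dvd_zero _ using 1
  linear_combination (-D.trans g) * hc

/-- Uniqueness of the fixed class: subtracting the two conditions gives `(mult g - 1) * (x - y)`,
whose first factor is a unit. -/
theorem dvd_sub_of_mem {u v d : ℕ} {x y : ZMod m} {g : G} (hg : D.proj g ≠ 1)
    (hu : g ∈ D.stab u x) (hv : g ∈ D.stab v y) (hdu : d ∣ u) (hdv : d ∣ v) :
    (d : ZMod m) ∣ x - y := by
  have hu' := (Nat.cast_dvd_cast (α := ZMod m) hdu).trans hu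
  have hv' := (Nat.cast_dvd_cast (α := ZMod m) hdv).trans hv
  rw [← (D.isUnit_mult_sub_one g hg).dvd_mul_left]
  convert dvd_sub hu' hv' using 1
  ring

theorem stab_congr {u : ℕ} {x y : ZMod m} (h : (u : ZMod m) ∣ x - y) : D.stab u x = D.stab u y := by
  ext g
  rw [mem_stab, mem_stab]
  refine dvd_iff_dvd_of_dvd_sub ?_
  convert h.mul_left ((D.mult g : ZMod m) - 1) using 1
  ring

theorem normal_transSubgroup (u : ℕ) : (D.transSubgroup u).Normal where
  conj_mem := by
    rintro g ⟨hg, hg'⟩ h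
    refine ⟨by simp [hg], ?_⟩
    have e : ((D.mult h : (ZMod m)ˣ) : ZMod m) * (D.mult h⁻¹ : (ZMod m)ˣ) = 1 := by
      rw [← Units.val_mul, ← map_mul]; simp
    rw [D.trans_mul, D.trans_mul, D.trans_inv, map_mul, D.mult_eq_one g hg]
    convert hg'.mul_left (D.mult h : ZMod m) using 1
    push_cast
    linear_combination (-D.trans h) * e

/-- The translations in `H` pull back to a subgroup of `ℤ`, which is cyclic; its generator divides
`m` because the identity is the translation by `m`. -/
theorem exists_dvd_of_subgroup (H : Subgroup G) :
    ∃ u, u ∣ m ∧ ∀ g, D.proj g = 1 → (g ∈ H ↔ (u : ZMod m) ∣ D.trans g) := by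
  let T : AddSubgroup ℤ :=
    { carrier := {k | ∃ g ∈ H, D.proj g = 1 ∧ D.trans g = k}
      zero_mem' := ⟨1, H.one_mem, by simp, by simp [D.trans_one]⟩
      add_mem' := by
        rintro a b ⟨g, hg, hg1, hga⟩ ⟨h, hh, hh1, hhb⟩
        exact ⟨g * h, H.mul_mem hg hh, by simp [hg1, hh1], by
          simp [D.trans_mul, D.mult_eq_one g hg1, hga, hhb]⟩
      neg_mem' := by
        rintro a ⟨g, hg, hg1, hga⟩
        exact ⟨g⁻¹, H.inv_mem hg, by simp [hg1], by
          simp [D.trans_inv, D.mult_eq_one g hg1, hga]⟩ }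
  obtain ⟨w, hw⟩ := Int.subgroup_cyclic T
  have hT : ∀ k : ℤ, k ∈ T ↔ (w.natAbs : ℤ) ∣ k := by
    intro k
    rw [hw, ← AddSubgroup.zmultiples_eq_closure, Int.mem_zmultiples_iff, Int.natAbs_dvd]
  have hm : w.natAbs ∣ m := by
    rw [← Int.natCast_dvd_natCast, ← hT]
    exact ⟨1, H.one_mem, by simp, by simp [D.trans_one]⟩
  refine ⟨w.natAbs, hm, fun g hg => ?_⟩
  obtain ⟨k, hk⟩ := ZMod.intCast_surjective (D.trans g)
  rw [← hk, ZMod.natCast_dvd_intCast_iff hm, ← hT]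
  constructor
  · exact fun h => ⟨g, h, hg, hk.symm⟩
  · rintro ⟨g', h', hp, ht⟩
    rwa [D.ext (ht.trans hk) (hp.trans hg.symm)] at h'

/-- As `n` is prime, `proj g` generates the quotient, so every element is a translation times a
power of the common element `g`. -/
theorem eq_of_inf_ker_eq (hn : n.Prime) {H K : Subgroup G} {g : G} (hg : D.proj g ≠ 1)
    (hH : g ∈ H) (hK : g ∈ K) (h : ∀ a, D.proj a = 1 → (a ∈ H ↔ a ∈ K)) : H = K := by
  ext a
  have : Fact (Nat.card (Multiplicative (ZMod n))).Prime :=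
    ⟨by rwa [Nat.card_congr Multiplicative.toAdd, Nat.card_zmod]⟩
  obtain ⟨k, hk⟩ := Subgroup.mem_zpowers_iff.1 (mem_zpowers_of_prime_card (g' := D.proj a) rfl hg)
  have := h (a * (g ^ k)⁻¹) (by simp [hk])
  rwa [Subgroup.mul_mem_cancel_right _ (H.inv_mem (H.zpow_mem hH k)),
    Subgroup.mul_mem_cancel_right _ (K.inv_mem (K.zpow_mem hK k))] at this

theorem eq_transSubgroup_or_eq_stab (hn : n.Prime) (H : Subgroup G) :
    ∃ u, u ∣ m ∧ (H = D.transSubgroup u ∨ ∃ x, H = D.stab u x) := by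
  obtain ⟨u, hu, h⟩ := D.exists_dvd_of_subgroup H
  refine ⟨u, hu, ?_⟩
  by_cases hH : ∃ g ∈ H, D.proj g ≠ 1
  · obtain ⟨g, hg, hg1⟩ := hH
    obtain ⟨x, hx⟩ := D.exists_fixed hg1
    refine Or.inr ⟨x, D.eq_of_inf_ker_eq hn hg1 hg (hx u) fun a ha => ?_⟩
    rw [h a ha, D.mem_stab_of_proj_eq_one ha]
  · push Not at hH
    left
    ext g
    rw [mem_transSubgroup]
    exact ⟨fun hg => ⟨hH g hg, (h g (hH g hg)).1 hg⟩, fun hg => (h g hg.1).2 hg.2⟩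

theorem dvd_of_forall_dvd_trans {u v : ℕ} (hu : u ∣ m)
    (h : ∀ g, D.proj g = 1 → (v : ZMod m) ∣ D.trans g → (u : ZMod m) ∣ D.trans g) : u ∣ v := by
  obtain ⟨g, ht, hp⟩ := D.exists_eq v 1
  have := h g hp (by rw [ht])
  rw [ht, ← Int.cast_natCast v, ZMod.natCast_dvd_intCast_iff hu] at this
  exact_mod_cast this

theorem transSubgroup_injective {u v : ℕ} (hu : u ∣ m) (hv : v ∣ m)
    (h : D.transSubgroup u = D.transSubgroup v) : u = v := by
  refine Nat.dvd_antisymm (D.dvd_of_forall_dvd_trans hu fun g hg hg' => ?_)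
    (D.dvd_of_forall_dvd_trans hv fun g hg hg' => ?_)
  · exact (h ▸ (show g ∈ D.transSubgroup v from ⟨hg, hg'⟩) : g ∈ D.transSubgroup u).2
  · exact (h ▸ (show g ∈ D.transSubgroup u from ⟨hg, hg'⟩) : g ∈ D.transSubgroup v).2

theorem exists_proj_ne_one (hn : n.Prime) : ∃ c : Multiplicative (ZMod n), c ≠ 1 := by
  have : Fact (1 < n) := ⟨hn.one_lt⟩
  exact exists_ne 1

theorem stab_injective (hn : n.Prime) {u v : ℕ} {x y : ZMod m} (hu : u ∣ m) (hv : v ∣ m)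
    (h : D.stab u x = D.stab v y) : u = v ∧ (u : ZMod m) ∣ x - y := by
  have huv : u = v := by
    refine Nat.dvd_antisymm (D.dvd_of_forall_dvd_trans hu fun g hg hg' => ?_)
      (D.dvd_of_forall_dvd_trans hv fun g hg hg' => ?_)
    · rwa [← D.mem_stab_of_proj_eq_one hg (x := x), h, D.mem_stab_of_proj_eq_one hg]
    · rwa [← D.mem_stab_of_proj_eq_one hg (x := y), ← h, D.mem_stab_of_proj_eq_one hg]
  subst huv
  obtain ⟨c, hc⟩ := exists_proj_ne_one hn
  obtain ⟨g, rfl, hg⟩ := D.exists_fixing x c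
  exact ⟨rfl, D.dvd_sub_of_mem hc (hg u) (h ▸ hg u) dvd_rfl dvd_rfl⟩

theorem transSubgroup_ne_stab (hn : n.Prime) (u v : ℕ) (x : ZMod m) :
    D.transSubgroup u ≠ D.stab v x := by
  intro h
  obtain ⟨c, hc⟩ := exists_proj_ne_one hn
  obtain ⟨g, rfl, hg⟩ := D.exists_fixing x c
  exact hc (h ▸ hg v : g ∈ D.transSubgroup u).1

theorem isCyclic_transSubgroup (u : ℕ) : IsCyclic (D.transSubgroup u) := by
  let f : D.transSubgroup u →* Multiplicative (ZMod m) :=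
    { toFun := fun g => Multiplicative.ofAdd (D.trans g)
      map_one' := by simp [D.trans_one]
      map_mul' := fun g h => by simp [D.trans_mul, D.mult_eq_one g g.2.1] }
  refine isCyclic_of_injective f fun g h hgh => Subtype.ext (D.ext ?_ (g.2.1.trans h.2.1.symm))
  exact Multiplicative.ofAdd.injective hgh

theorem isCyclic_stab_iff (hn : n.Prime) {u : ℕ} (hu : u ∣ m) (x : ZMod m) :
    IsCyclic (D.stab u x) ↔ u = m := by
  -- A generator fixes some point `y`, so the whole group fixes `y` and contains no nonzero
  -- translation.
  have key : ∀ {u : ℕ} {x : ZMod m} {g : G}, u ∣ m → D.proj g ≠ 1 →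
      D.stab u x = Subgroup.zpowers g → u = m := by
    intro u x g hu hg h
    obtain ⟨y, hy⟩ := D.exists_fixed hg
    refine Nat.dvd_antisymm hu (D.dvd_of_forall_dvd_trans dvd_rfl fun a ha ha' => ?_)
    rw [← D.mem_stab_of_proj_eq_one ha (x := x), h] at ha'
    rw [← D.mem_stab_of_proj_eq_one ha (x := y)]
    exact (Subgroup.zpowers_le.2 (hy m)) ha'
  obtain ⟨c, hc⟩ := exists_proj_ne_one hn
  obtain ⟨g, rfl, hg⟩ := D.exists_fixing x c
  constructor
  · intro h
    obtain ⟨a, ha⟩ := (Subgroup.isCyclic_iff_exists_zpowers_eq_top _).1 h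
    refine key hu (g := a) (fun h1 => hc ?_) ha.symm
    obtain ⟨k, hk⟩ := Subgroup.mem_zpowers_iff.1 (ha ▸ hg u)
    rw [← hk, map_zpow, h1, one_zpow]
  · rintro rfl
    suffices D.stab u x = Subgroup.zpowers g by rw [this]; infer_instance
    refine D.eq_of_inf_ker_eq hn hc (hg u) (Subgroup.mem_zpowers g) fun a ha => ?_
    constructor
    · intro h
      rw [D.mem_stab_of_proj_eq_one ha, ZMod.natCast_self, zero_dvd_iff] at h
      rw [D.ext (h.trans D.trans_one.symm) (ha.trans (map_one _).symm)]
      exact one_mem _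
    · exact fun h => (Subgroup.zpowers_le.2 (hg u)) h

/-! ### Permuting stabilisers. -/

theorem stab_mul_stab (u v : ℕ) (z : ZMod m) :
    (D.stab u z : Set G) * D.stab v z = D.stab (Nat.gcd u v) z := by
  ext g
  constructor
  · rintro ⟨h, hh, k, hk, rfl⟩
    exact mul_mem ((Nat.cast_dvd_cast (Nat.gcd_dvd_left u v)).trans hh)
      ((Nat.cast_dvd_cast (Nat.gcd_dvd_right u v)).trans hk)
  · intro hg
    -- Dividing `g` by an element `p` that fixes `z` leaves a translation by a multiple of `gcd(u,
    -- v)`, which Bézout splits into multiples of `u` and of `v`.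
    obtain ⟨p, hp, hpz⟩ := D.exists_fixing z (D.proj g)
    have hq : D.proj (g * p⁻¹) = 1 := by simp [hp]
    have hgp : g * p⁻¹ ∈ D.stab (Nat.gcd u v) z := mul_mem hg (inv_mem (hpz _))
    obtain ⟨c, hc⟩ := (D.mem_stab_of_proj_eq_one hq).1 hgp
    have hgcd : ((Nat.gcd u v : ℕ) : ZMod m) = u * (Nat.gcdA u v : ℤ) + v * (Nat.gcdB u v : ℤ) := by
      exact_mod_cast congrArg (Int.cast : ℤ → ZMod m) (Nat.gcd_eq_gcd_ab u v)
    obtain ⟨a, hat, hap⟩ := D.exists_eq (u * ((Nat.gcdA u v : ℤ) * c)) 1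
    refine ⟨a, (D.mem_stab_of_proj_eq_one hap).2 (hat ▸ dvd_mul_right _ _), a⁻¹ * (g * p⁻¹) * p,
      mul_mem ((D.mem_stab_of_proj_eq_one (by simp [hap, hp])).2 ?_) (hpz v), by
        simp [mul_assoc]⟩
    refine ⟨(Nat.gcdB u v : ℤ) * c, ?_⟩
    rw [D.trans_mul, hc, D.trans_inv, hat, D.mult_eq_one a⁻¹ (by simp [hap]), hgcd]
    push_cast
    ring

end AffineData

/-- Two permuting subgroups, with their product. -/
theorem Subgroup.exists_coe_eq_mul_of_mul_comm {G : Type*} [Group G] {H K : Subgroup G}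
    (h : (H : Set G) * K = (K : Set G) * H) : ∃ L : Subgroup G, (L : Set G) = (H : Set G) * K := by
  refine ⟨{ carrier := (H : Set G) * K, one_mem' := ⟨1, one_mem _, 1, one_mem _, by simp⟩,
            mul_mem' := ?_, inv_mem' := ?_ }, rfl⟩
  · intro a b ha hb
    have : a * b ∈ ((H : Set G) * K) * ((H : Set G) * K) := Set.mul_mem_mul ha hb
    rwa [mul_assoc, ← mul_assoc (K : Set G), ← h, mul_assoc, ← mul_assoc, coe_mul_coe,
      coe_mul_coe] at this
  · intro a ha
    have : a⁻¹ ∈ ((H : Set G) * K)⁻¹ := Set.inv_mem_inv.2 ha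
    rwa [mul_inv_rev, inv_coe_set, inv_coe_set, ← h] at this

namespace AffineData

variable {G : Type*} [Group G] {m n : ℕ} (D : AffineData G m n)

theorem dvd_sub_of_stab_mul_comm (hn : n.Prime) {u v : ℕ} {x y : ZMod m}
    (h : (D.stab u x : Set G) * D.stab v y = (D.stab v y : Set G) * D.stab u x) :
    ((Nat.gcd u v : ℕ) : ZMod m) ∣ x - y := by
  obtain ⟨L, hL⟩ := Subgroup.exists_coe_eq_mul_of_mul_comm h
  have hHL : ∀ g ∈ D.stab u x, g ∈ L := fun g hg => by
    rw [← SetLike.mem_coe, hL]; exact ⟨g, hg, 1, one_mem _, by simp⟩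
  have hKL : ∀ g ∈ D.stab v y, g ∈ L := fun g hg => by
    rw [← SetLike.mem_coe, hL]; exact ⟨1, one_mem _, g, hg, by simp⟩
  obtain ⟨c, hc⟩ := exists_proj_ne_one hn
  obtain ⟨p, hp, hpx⟩ := D.exists_fixing x c
  obtain ⟨q, hq, hqy⟩ := D.exists_fixing y c
  -- The product `L` contains elements fixing `x` and `y`, so it stabilises a class containing both;
  -- hence it contains the translation taking `x` to `y`.
  obtain ⟨l, hlt, hlp⟩ := D.exists_eq (y - x) 1
  have hl : l ∈ L := by
    obtain ⟨w, -, rfl | ⟨z, rfl⟩⟩ := D.eq_transSubgroup_or_eq_stab hn L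
    · exact absurd (hHL p (hpx u)).1 (hp ▸ hc)
    · rw [D.mem_stab_of_proj_eq_one hlp, hlt]
      have h1 := D.dvd_sub_of_mem (hp ▸ hc) (hHL p (hpx u)) (hpx w) dvd_rfl dvd_rfl
      have h2 := D.dvd_sub_of_mem (hq ▸ hc) (hKL q (hqy v)) (hqy w) dvd_rfl dvd_rfl
      convert dvd_sub h1 h2 using 1
      ring
  -- Write this translation as `k * g` with `g` acting first. Modulo `gcd(u, v)`, `g` fixes `x`, so
  -- `k` sends `x` to `y`; but `k` also fixes `y`, and it is injective.
  rw [← SetLike.mem_coe, hL, h] at hl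
  obtain ⟨k, hk, g, hg, rfl⟩ := hl
  have hk' := (Nat.cast_dvd_cast (α := ZMod m) (Nat.gcd_dvd_right u v)).trans hk
  have hg' := (Nat.cast_dvd_cast (α := ZMod m) (Nat.gcd_dvd_left u v)).trans hg
  have e : (D.mult k : ZMod m) * D.mult g = 1 := by
    rw [← Units.val_mul, ← map_mul, D.mult_eq_one _ hlp, Units.val_one]
  simp only [D.trans_mul] at hlt
  rw [← (D.mult k).isUnit.dvd_mul_left]
  convert (dvd_add hk' (hg'.mul_left (D.mult k : ZMod m))).neg_right using 1
  linear_combination hlt + x * e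

theorem stab_mul_comm_of_dvd_sub {u v : ℕ} {x y : ZMod m}
    (h : ((Nat.gcd u v : ℕ) : ZMod m) ∣ x - y) :
    (D.stab u x : Set G) * D.stab v y = (D.stab v y : Set G) * D.stab u x := by
  obtain ⟨c, hc⟩ := h
  have hgcd : ((Nat.gcd u v : ℕ) : ZMod m) = u * (Nat.gcdA u v : ℤ) + v * (Nat.gcdB u v : ℤ) := by
    exact_mod_cast congrArg (Int.cast : ℤ → ZMod m) (Nat.gcd_eq_gcd_ab u v)
  rw [hgcd] at hc
  -- The new base point is congruent to `x` mod `u` and to `y` mod `v`, so both groups become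
  -- stabilisers of classes of one point.
  rw [D.stab_congr (u := u) (x := x) (y := x - u * ((Nat.gcdA u v : ℤ) * c))
      ⟨(Nat.gcdA u v : ℤ) * c, by ring⟩,
    D.stab_congr (u := v) (x := y) (y := x - u * ((Nat.gcdA u v : ℤ) * c))
      ⟨-((Nat.gcdB u v : ℤ) * c), by linear_combination -hc⟩,
    stab_mul_stab, stab_mul_stab, Nat.gcd_comm]

theorem stab_mul_comm_iff (hn : n.Prime) {u v : ℕ} {x y : ZMod m} :
    (D.stab u x : Set G) * D.stab v y = (D.stab v y : Set G) * D.stab u x ↔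
      ((Nat.gcd u v : ℕ) : ZMod m) ∣ x - y :=
  ⟨D.dvd_sub_of_stab_mul_comm hn, D.stab_mul_comm_of_dvd_sub⟩

theorem transSubgroup_mul_comm (u : ℕ) (H : Subgroup G) :
    (D.transSubgroup u : Set G) * H = (H : Set G) * D.transSubgroup u := by
  have := D.normal_transSubgroup u
  exact (Subgroup.set_mul_normal_comm _ _).symm

end AffineData

/-! ### Counting pairs, and the sum of least common multiples. -/

theorem Nat.card_pairs_eq_sum {I S : Type*} [Fintype I] (f : I → S) (hf : Function.Bijective f)
    (R : S → S → Prop) [∀ i j, Decidable (R (f i) (f j))] :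
    Nat.card {p : S × S // R p.1 p.2} = ∑ i, ∑ j, if R (f i) (f j) then 1 else 0 := by
  have e : {p : I × I // R (f p.1) (f p.2)} ≃ {p : S × S // R p.1 p.2} :=
    ((Equiv.ofBijective f hf).prodCongr (Equiv.ofBijective f hf)).subtypeEquiv fun _ => Iff.rfl
  rw [← Nat.card_congr e, Nat.card_eq_fintype_card, Fintype.card_subtype, Finset.card_filter,
    ← Finset.univ_product_univ, Finset.sum_product]

/-- Chinese remainder theorem for moduli that need not be coprime: `z ↦ (z % u, z % v)` is a
bijection from the residues mod `lcm(u, v)` to the compatible pairs. -/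
theorem Nat.sum_range_modEq_gcd {u v : ℕ} (hu : 0 < u) (hv : 0 < v) :
    ∑ x ∈ Finset.range u, ∑ y ∈ Finset.range v,
      (if x ≡ y [MOD Nat.gcd u v] then 1 else 0) = Nat.lcm u v := by
  rw [← Finset.sum_product', ← Finset.card_filter]
  conv_rhs => rw [← Finset.card_range (Nat.lcm u v)]
  symm
  refine Finset.card_nbij (fun z => (z % u, z % v)) ?_ ?_ ?_
  · intro z _
    simp only [Finset.coe_filter, Finset.mem_product, Finset.mem_range, Set.mem_ofPred_eq]
    exact ⟨⟨Nat.mod_lt _ hu, Nat.mod_lt _ hv⟩,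
      ((Nat.mod_modEq z u).of_dvd (Nat.gcd_dvd_left u v)).trans
        ((Nat.mod_modEq z v).of_dvd (Nat.gcd_dvd_right u v)).symm⟩
  · intro z hz w hw h
    simp only [Prod.mk.injEq] at h
    simp only [Finset.coe_range, Set.mem_Iio] at hz hw
    exact (Nat.mod_lcm h.1 h.2).eq_of_lt_of_lt hz hw
  · rintro ⟨x, y⟩ h
    simp only [Finset.coe_filter, Finset.mem_product, Finset.mem_range, Set.mem_ofPred_eq] at h
    obtain ⟨⟨hx, hy⟩, h⟩ := h
    refine ⟨Nat.chineseRemainder' h, ?_, ?_⟩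
    · simpa using Nat.chineseRemainder'_lt_lcm h hu.ne' hv.ne'
    · have := (Nat.chineseRemainder' h).2
      exact Prod.ext (Eq.trans this.1 (Nat.mod_eq_of_lt hx)) (Eq.trans this.2 (Nat.mod_eq_of_lt hy))

/-- Replace `u`, `v` by `m / u`, `m / v` and use `gcd(m / u, m / v) = m / lcm(u, v)`. -/
theorem gcdSum_eq_sum_lcm (m : ℕ) :
    gcdSum m = ∑ u ∈ m.divisors, ∑ v ∈ m.divisors, (Nat.lcm u v : ℚ) := by
  rw [gcdSum, ← Nat.sum_div_divisors m fun u => ∑ v ∈ m.divisors, 1 / (Nat.gcd u v : ℚ),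
    Finset.mul_sum]
  refine Finset.sum_congr rfl fun u hu => ?_
  rw [← Nat.sum_div_divisors m fun v => 1 / (Nat.gcd (m / u) v : ℚ), Finset.mul_sum]
  refine Finset.sum_congr rfl fun v hv => ?_
  have hm := (Nat.mem_divisors.1 hu).2
  have hu := (Nat.mem_divisors.1 hu).1
  have hv := (Nat.mem_divisors.1 hv).1
  have hl : Nat.lcm u v ∣ m := Nat.lcm_dvd hu hv
  have key : Nat.gcd (m / u) (m / v) = m / Nat.lcm u v := by
    refine Nat.dvd_antisymm ?_ (Nat.dvd_gcd (Nat.div_dvd_div_left hl (Nat.dvd_lcm_left u v))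
      (Nat.div_dvd_div_left hl (Nat.dvd_lcm_right u v)))
    refine Nat.dvd_div_of_mul_dvd ?_
    rw [← Nat.lcm_mul_right]
    exact Nat.lcm_dvd (Nat.mul_dvd_of_dvd_div hu (Nat.gcd_dvd_left _ _))
      (Nat.mul_dvd_of_dvd_div hv (Nat.gcd_dvd_right _ _))
  rw [key, Nat.cast_div hl (by have := ne_zero_of_dvd_ne_zero hm hl; exact_mod_cast this)]
  have : (m : ℚ) ≠ 0 := by exact_mod_cast hm
  field_simp

theorem ZMod.natCast_dvd_natCast_sub_iff {m d x y : ℕ} (hd : d ∣ m) :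
    (d : ZMod m) ∣ (x : ZMod m) - y ↔ x ≡ y [MOD d] := by
  have := ZMod.natCast_dvd_intCast_iff hd ((x : ℤ) - y)
  push_cast at this
  rw [this, Nat.ModEq.comm, Nat.modEq_iff_dvd]

/-! ### The two degrees of an affine group. -/

namespace AffineData

variable {G : Type*} [Group G] {m n : ℕ} (D : AffineData G m n)

theorem exists_lt_stab_eq (hm : m ≠ 0) {u : ℕ} (hu : u ∣ m) (x : ZMod m) :
    ∃ k < u, D.stab u (k : ZMod m) = D.stab u x := by
  have : NeZero m := ⟨hm⟩
  refine ⟨x.val % u, Nat.mod_lt _ (Nat.pos_of_dvd_of_pos hu (Nat.pos_of_ne_zero hm)),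
    D.stab_congr ?_⟩
  rw [← ZMod.natCast_zmod_val x, ZMod.natCast_dvd_natCast_sub_iff hu, ZMod.natCast_zmod_val]
  exact Nat.mod_modEq _ _

/-- The parametrisation of all the subgroups. -/
def toSubgroup : m.divisors ⊕ (Σ u : m.divisors, Fin u) → Subgroup G :=
  Sum.elim (fun u => D.transSubgroup u) fun p => D.stab p.1 ((p.2 : ℕ) : ZMod m)

theorem bijective_toSubgroup (hn : n.Prime) (hm : m ≠ 0) : Function.Bijective D.toSubgroup := by
  constructor
  · rintro (⟨u, hu⟩ | ⟨⟨u, hu⟩, x, hx⟩) (⟨v, hv⟩ | ⟨⟨v, hv⟩, y, hy⟩) h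
    · obtain rfl := D.transSubgroup_injective (Nat.dvd_of_mem_divisors hu)
        (Nat.dvd_of_mem_divisors hv) h
      rfl
    · exact absurd h (D.transSubgroup_ne_stab hn _ _ _)
    · exact absurd h.symm (D.transSubgroup_ne_stab hn _ _ _)
    · obtain ⟨rfl, hxy⟩ := D.stab_injective hn (Nat.dvd_of_mem_divisors hu)
        (Nat.dvd_of_mem_divisors hv) h
      obtain rfl := ((ZMod.natCast_dvd_natCast_sub_iff (Nat.dvd_of_mem_divisors hu)).1
        hxy).eq_of_lt_of_lt hx hy
      rfl
  · intro H
    obtain ⟨u, hu, rfl | ⟨x, rfl⟩⟩ := D.eq_transSubgroup_or_eq_stab hn H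
    · exact ⟨Sum.inl ⟨u, Nat.mem_divisors.2 ⟨hu, hm⟩⟩, rfl⟩
    · obtain ⟨k, hk, h⟩ := D.exists_lt_stab_eq hm hu x
      exact ⟨Sum.inr ⟨⟨u, Nat.mem_divisors.2 ⟨hu, hm⟩⟩, k, hk⟩, h⟩

/-- The parametrisation of the cyclic subgroups. -/
def toCyclicSubgroup (hn : n.Prime) : m.divisors ⊕ Fin m → CyclicSubgroup G :=
  Sum.elim (fun u => ⟨D.transSubgroup u, D.isCyclic_transSubgroup u⟩)
    fun x => ⟨D.stab m ((x : ℕ) : ZMod m), (D.isCyclic_stab_iff hn dvd_rfl _).2 rfl⟩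

theorem bijective_toCyclicSubgroup (hn : n.Prime) (hm : m ≠ 0) :
    Function.Bijective (D.toCyclicSubgroup hn) := by
  constructor
  · rintro (⟨u, hu⟩ | x) (⟨v, hv⟩ | y) h
    · obtain rfl := D.transSubgroup_injective (Nat.dvd_of_mem_divisors hu)
        (Nat.dvd_of_mem_divisors hv) (congrArg Subtype.val h)
      rfl
    · exact absurd (congrArg Subtype.val h) (D.transSubgroup_ne_stab hn _ _ _)
    · exact absurd (congrArg Subtype.val h).symm (D.transSubgroup_ne_stab hn _ _ _)
    · have hxy := (D.stab_injective hn dvd_rfl dvd_rfl (congrArg Subtype.val h)).2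
      rw [Fin.ext (((ZMod.natCast_dvd_natCast_sub_iff dvd_rfl).1 hxy).eq_of_lt_of_lt x.2 y.2)]
  · rintro ⟨H, hH⟩
    obtain ⟨u, hu, rfl | ⟨x, rfl⟩⟩ := D.eq_transSubgroup_or_eq_stab hn H
    · exact ⟨Sum.inl ⟨u, Nat.mem_divisors.2 ⟨hu, hm⟩⟩, rfl⟩
    · obtain rfl := (D.isCyclic_stab_iff hn hu x).1 hH
      obtain ⟨k, hk, h⟩ := D.exists_lt_stab_eq hm hu x
      exact ⟨Sum.inr ⟨k, hk⟩, Subtype.ext h⟩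

theorem sd_eq (D : AffineData G m n) (hn : n.Prime) (hm : m ≠ 0) : sd G = sdValue m := by
  classical
  have h1 : Nat.card (Subgroup G) = m.divisors.card + ∑ u ∈ m.divisors, u := by
    rw [← Nat.card_congr (Equiv.ofBijective _ (D.bijective_toSubgroup hn hm)),
      Nat.card_eq_fintype_card, Fintype.card_sum, Fintype.card_sigma]
    simp [Finset.sum_attach m.divisors fun u => u]
  have hpos : ∀ u : m.divisors, 0 < (u : ℕ) := fun u => Nat.pos_of_mem_divisors u.2
  have h2 : Nat.card {p : Subgroup G × Subgroup G //
      (p.1 : Set G) * (p.2 : Set G) = (p.2 : Set G) * (p.1 : Set G)} =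
      m.divisors.card ^ 2 + 2 * m.divisors.card * ∑ u ∈ m.divisors, u +
        ∑ u ∈ m.divisors, ∑ v ∈ m.divisors, Nat.lcm u v := by
    -- This is the contribution of pairs of stabilisers; every pair involving a translation group
    -- permutes.
    have hl : ∑ u ∈ m.divisors, ∑ v ∈ m.divisors, Nat.lcm u v =
        ∑ p : Σ u : m.divisors, Fin u, ∑ q : Σ u : m.divisors, Fin u,
          if (p.2 : ℕ) ≡ q.2 [MOD Nat.gcd p.1 q.1] then 1 else 0 := by
      simp_rw [Fintype.sum_sigma]
      rw [← Finset.sum_coe_sort]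
      refine Finset.sum_congr rfl fun u _ => ?_
      rw [Finset.sum_comm, ← Finset.sum_coe_sort]
      refine Finset.sum_congr rfl fun v _ => ?_
      rw [← Nat.sum_range_modEq_gcd (hpos u) (hpos v), Finset.sum_range]
      refine Finset.sum_congr rfl fun x _ => ?_
      rw [Finset.sum_range]
    rw [Nat.card_pairs_eq_sum D.toSubgroup (D.bijective_toSubgroup hn hm)
      fun H K => (H : Set G) * (K : Set G) = (K : Set G) * (H : Set G), hl]
    have e : ∀ p q : Σ u : m.divisors, Fin u,
        ((D.stab p.1 ((p.2 : ℕ) : ZMod m) : Set G) * D.stab q.1 ((q.2 : ℕ) : ZMod m) =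
          (D.stab q.1 ((q.2 : ℕ) : ZMod m) : Set G) * D.stab p.1 ((p.2 : ℕ) : ZMod m)) ↔
          (p.2 : ℕ) ≡ q.2 [MOD Nat.gcd p.1 q.1] := fun p q => by
      rw [D.stab_mul_comm_iff hn, ZMod.natCast_dvd_natCast_sub_iff
        ((Nat.gcd_dvd_left _ _).trans (Nat.dvd_of_mem_divisors p.1.2))]
    have e₁ : ∀ (u : ℕ) (H : Subgroup G),
        ((D.transSubgroup u : Set G) * H = (H : Set G) * D.transSubgroup u) ↔ True :=
      fun u H => iff_true_intro (D.transSubgroup_mul_comm u H)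
    have e₂ : ∀ (u : ℕ) (H : Subgroup G),
        ((H : Set G) * D.transSubgroup u = (D.transSubgroup u : Set G) * H) ↔ True :=
      fun u H => iff_true_intro (D.transSubgroup_mul_comm u H).symm
    simp only [Fintype.sum_sum_type, toSubgroup, Sum.elim_inl, Sum.elim_inr,
      e₁, e₂, if_true, e]
    rw [Finset.sum_add_distrib, Finset.sum_add_distrib]
    simp [Finset.sum_attach m.divisors fun u => u]
    ring
  rw [sd, sdValue, h1, h2, gcdSum_eq_sum_lcm, tauQ, sigmaQ, ArithmeticFunction.sigma_zero_apply,
    ArithmeticFunction.sigma_one_apply]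
  push_cast
  rfl

theorem csd_eq (D : AffineData G m n) (hn : n.Prime) (hm : m ≠ 0) : csd G = csdValue m := by
  classical
  have h1 : Nat.card (CyclicSubgroup G) = m.divisors.card + m := by
    rw [← Nat.card_congr (Equiv.ofBijective _ (D.bijective_toCyclicSubgroup hn hm)),
      Nat.card_eq_fintype_card, Fintype.card_sum]
    simp
  have h2 : Nat.card {p : CyclicSubgroup G × CyclicSubgroup G //
      (p.1.1 : Set G) * (p.2.1 : Set G) = (p.2.1 : Set G) * (p.1.1 : Set G)} =
      m.divisors.card * (m.divisors.card + m) + m * (m.divisors.card + 1) := by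
    rw [Nat.card_pairs_eq_sum (D.toCyclicSubgroup hn) (D.bijective_toCyclicSubgroup hn hm)
      fun H K => (H.1 : Set G) * (K.1 : Set G) = (K.1 : Set G) * (H.1 : Set G)]
    have e : ∀ p q : Fin m,
        ((D.stab m ((p : ℕ) : ZMod m) : Set G) * D.stab m ((q : ℕ) : ZMod m) =
          (D.stab m ((q : ℕ) : ZMod m) : Set G) * D.stab m ((p : ℕ) : ZMod m)) ↔ p = q :=
      fun p q => by
        rw [D.stab_mul_comm_iff hn, Nat.gcd_self, ZMod.natCast_dvd_natCast_sub_iff dvd_rfl]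
        exact ⟨fun h => Fin.ext (h.eq_of_lt_of_lt p.2 q.2), fun h => h ▸ Nat.ModEq.refl _⟩
    have e₁ : ∀ (u : ℕ) (H : Subgroup G),
        ((D.transSubgroup u : Set G) * H = (H : Set G) * D.transSubgroup u) ↔ True :=
      fun u H => iff_true_intro (D.transSubgroup_mul_comm u H)
    have e₂ : ∀ (u : ℕ) (H : Subgroup G),
        ((H : Set G) * D.transSubgroup u = (D.transSubgroup u : Set G) * H) ↔ True :=
      fun u H => iff_true_intro (D.transSubgroup_mul_comm u H).symm
    simp only [Fintype.sum_sum_type, toCyclicSubgroup, Sum.elim_inl, Sum.elim_inr,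
      e₁, e₂, if_true, e]
    simp
  rw [csd, csdValue, h1, h2, tauQ, ArithmeticFunction.sigma_zero_apply]
  push_cast
  rfl

end AffineData

/-! ### Generators and normal form of `ZM m n r`. -/

namespace ZM

variable (m n r : ℕ)

/-- The generator `a`. -/
def genA : ZM m n r := PresentedGroup.of ZMGen.a

/-- The generator `b`. -/
def genB : ZM m n r := PresentedGroup.of ZMGen.b

theorem genA_pow : genA m n r ^ m = 1 :=
  PresentedGroup.one_of_mem (rels := zmRelators m n r) (x := FreeGroup.of ZMGen.a ^ m)
    (by simp [zmRelators])

theorem genB_pow : genB m n r ^ n = 1 :=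
  PresentedGroup.one_of_mem (rels := zmRelators m n r) (x := FreeGroup.of ZMGen.b ^ n)
    (by simp [zmRelators])

theorem conj_genA : (genB m n r)⁻¹ * genA m n r * genB m n r = genA m n r ^ r :=
  PresentedGroup.mk_eq_mk_of_mul_inv_mem (rels := zmRelators m n r)
    (x := (FreeGroup.of ZMGen.b)⁻¹ * FreeGroup.of ZMGen.a * FreeGroup.of ZMGen.b)
    (y := FreeGroup.of ZMGen.a ^ r) (by simp [zmRelators])

variable {m n r}

/-- The homomorphism determined by a pair of elements satisfying the relations. -/
def lift {G : Type*} [Group G] (x y : G) (hx : x ^ m = 1) (hy : y ^ n = 1)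
    (h : y⁻¹ * x * y = x ^ r) : ZM m n r →* G :=
  PresentedGroup.toGroup (f := fun i => ZMGen.casesOn i x y) (by
    rintro _ (rfl | rfl | rfl)
    · simpa using hx
    · simpa using hy
    · simp [h])

section lift

variable {G : Type*} [Group G] {x y : G} (hx : x ^ m = 1) (hy : y ^ n = 1)
    (h : y⁻¹ * x * y = x ^ r)

@[simp]
theorem lift_genA : lift x y hx hy h (genA m n r) = x := PresentedGroup.toGroup.of _

@[simp]
theorem lift_genB : lift x y hx hy h (genB m n r) = y := PresentedGroup.toGroup.of _

end lift

theorem mem_of_genA_of_genB (H : Subgroup (ZM m n r)) (ha : genA m n r ∈ H) (hb : genB m n r ∈ H)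
    (g : ZM m n r) : g ∈ H :=
  PresentedGroup.generated_by _ H (fun i => by cases i <;> assumption) g

theorem genA_zpow_congr {i j : ℤ} (h : (i : ZMod m) = j) : genA m n r ^ i = genA m n r ^ j := by
  rw [← orderOf_dvd_sub_iff_zpow_eq_zpow]
  exact (Int.natCast_dvd_natCast.2 (orderOf_dvd_of_pow_eq_one (genA_pow m n r))).trans
    ((ZMod.intCast_zmod_eq_zero_iff_dvd _ _).1 (by push_cast; rw [h, sub_self]))

theorem genB_zpow_congr {i j : ℤ} (h : (i : ZMod n) = j) : genB m n r ^ i = genB m n r ^ j := by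
  rw [← orderOf_dvd_sub_iff_zpow_eq_zpow]
  exact (Int.natCast_dvd_natCast.2 (orderOf_dvd_of_pow_eq_one (genB_pow m n r))).trans
    ((ZMod.intCast_zmod_eq_zero_iff_dvd _ _).1 (by push_cast; rw [h, sub_self]))

theorem normal_zpowers_genA (hn : n ≠ 0) (h : IsZMTriple m n r) :
    (Subgroup.zpowers (genA m n r)).Normal := by
  set a := genA m n r with ha
  set b := genB m n r with hb
  have hab : b⁻¹ * a * b = a ^ r := conj_genA m n r
  have har : a ^ (r ^ n) = a := by
    have : a ^ ((r ^ n : ℕ) : ℤ) = a ^ (1 : ℤ) := genA_zpow_congr (by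
      have := (ZMod.natCast_eq_natCast_iff _ _ _).2 h.pow_modEq
      push_cast at this ⊢
      exact this)
    rwa [zpow_natCast, zpow_one] at this
  -- Finiteness is not yet known, so normality needs conjugation in both directions. Conjugating by
  -- `b⁻¹` raises to the power `r`; the inverse is the power `r ^ (n - 1)`, as `r ^ n ≡ 1`.
  have hba : b * a * b⁻¹ = a ^ (r ^ (n - 1)) := by
    have h1 : b⁻¹ * a ^ (r ^ (n - 1)) * b = a := by
      have h2 := conj_pow (a := b⁻¹) (b := a) (i := r ^ (n - 1))
      rw [inv_inv, hab, ← pow_mul, mul_pow_sub_one hn, har] at h2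
      exact h2.symm
    calc b * a * b⁻¹ = b * (b⁻¹ * a ^ (r ^ (n - 1)) * b) * b⁻¹ := by rw [h1]
      _ = _ := by group
  rw [← Subgroup.normalizer_eq_top_iff, eq_top_iff]
  refine fun g _ => mem_of_genA_of_genB _ (Subgroup.le_normalizer (Subgroup.mem_zpowers a)) ?_ g
  rw [Subgroup.mem_normalizer_iff]
  intro x
  constructor
  · rintro ⟨k, rfl⟩
    change b * a ^ k * b⁻¹ ∈ _
    rw [← conj_zpow, hba]
    exact zpow_mem (pow_mem (Subgroup.mem_zpowers a) _) _
  · rintro ⟨k, hk⟩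
    change a ^ k = b * x * b⁻¹ at hk
    have hx : x = b⁻¹ * a ^ k * b⁻¹⁻¹ := by rw [hk]; group
    rw [hx, ← conj_zpow, inv_inv, hab]
    exact zpow_mem (pow_mem (Subgroup.mem_zpowers a) _) _

theorem exists_eq_zpow_mul_zpow (hn : n ≠ 0) (h : IsZMTriple m n r) (g : ZM m n r) :
    ∃ i j : ℤ, g = genA m n r ^ i * genB m n r ^ j := by
  have := normal_zpowers_genA hn h
  have := mem_of_genA_of_genB (Subgroup.zpowers (genA m n r) ⊔ Subgroup.zpowers (genB m n r))
    (Subgroup.mem_sup_left (Subgroup.mem_zpowers _))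
    (Subgroup.mem_sup_right (Subgroup.mem_zpowers _)) g
  rw [← SetLike.mem_coe, Subgroup.normal_mul] at this
  obtain ⟨_, ⟨i, rfl⟩, _, ⟨j, rfl⟩, rfl⟩ := this
  exact ⟨i, j, rfl⟩

end ZM

/-! ### Invariance under isomorphism, and the dihedral parameters. -/

theorem Subgroup.coe_mul_comm_map_iff {G G' : Type*} [Group G] [Group G'] (e : G ≃* G')
    (H K : Subgroup G) :
    ((H.map e.toMonoidHom : Set G') * (K.map e.toMonoidHom : Set G') =
      (K.map e.toMonoidHom : Set G') * (H.map e.toMonoidHom : Set G')) ↔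
    (H : Set G) * K = (K : Set G) * H := by
  rw [coe_map, coe_map, ← Set.image_mul, ← Set.image_mul]
  exact (Set.image_injective.2 e.injective).eq_iff

theorem sd_congr {G G' : Type*} [Group G] [Group G'] (e : G ≃* G') : sd G = sd G' := by
  let f : Subgroup G ≃ Subgroup G' := e.mapSubgroup.toEquiv
  let F : {p : Subgroup G × Subgroup G // (p.1 : Set G) * (p.2 : Set G) = (p.2 : Set G) * p.1} ≃
      {p : Subgroup G' × Subgroup G' // (p.1 : Set G') * (p.2 : Set G') = (p.2 : Set G') * p.1} :=
    (f.prodCongr f).subtypeEquiv fun p => (Subgroup.coe_mul_comm_map_iff e p.1 p.2).symm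
  rw [sd, sd, Nat.card_congr f, Nat.card_congr F]

theorem csd_congr {G G' : Type*} [Group G] [Group G'] (e : G ≃* G') : csd G = csd G' := by
  let f : CyclicSubgroup G ≃ CyclicSubgroup G' := e.mapSubgroup.toEquiv.subtypeEquiv fun H =>
    (e.subgroupMap H).isCyclic
  let F : {p : CyclicSubgroup G × CyclicSubgroup G //
        (p.1.1 : Set G) * (p.2.1 : Set G) = (p.2.1 : Set G) * p.1.1} ≃
      {p : CyclicSubgroup G' × CyclicSubgroup G' //
        (p.1.1 : Set G') * (p.2.1 : Set G') = (p.2.1 : Set G') * p.1.1} :=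
    (f.prodCongr f).subtypeEquiv fun p => (Subgroup.coe_mul_comm_map_iff e p.1.1 p.2.1).symm
  rw [csd, csd, Nat.card_congr f, Nat.card_congr F]

theorem IsZMTriple.of_odd {m : ℕ} (hm : Odd m) (h3 : 3 ≤ m) : IsZMTriple m 2 (m - 1) := by
  obtain ⟨k, rfl⟩ := hm
  refine ⟨by simp, ?_, ?_⟩
  · have : (((2 * k + 1 - 1 : ℕ) : ℤ) - 1) = ((2 * k + 1 : ℕ) : ℤ) - 2 := by push_cast; omega
    rw [this]
    have : IsCoprime ((2 * k + 1 : ℕ) : ℤ) (((2 * k + 1 : ℕ) : ℤ) - 2) :=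
      -- Bézout coefficients for `m = 2k + 1` and `m - 2 = 2k - 1`.
      ⟨1 - k, k, by push_cast; ring⟩
    exact Int.isCoprime_iff_gcd_eq_one.1 this
  · rw [Nat.ModEq.comm, Nat.modEq_iff_dvd]
    -- `(m - 1)² - 1 = m (m - 2)`.
    exact ⟨2 * k - 1, by push_cast [Nat.add_sub_cancel]; ring⟩

/-! ### The affine action of `ZM m n r`. -/

namespace ZM

variable {m n r : ℕ}

theorem coprime_of_isZMTriple (hn : n ≠ 0) (h : IsZMTriple m n r) : r.Coprime m := by
  have h1 : (r ^ n).Coprime m := by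
    rw [Nat.Coprime, h.pow_modEq.gcd_eq, Nat.gcd_one_left]
  exact (Nat.coprime_pow_left_iff (Nat.pos_of_ne_zero hn) _ _).1 h1

/-- The inverse of `r` modulo `m`. -/
def ratio (hn : n ≠ 0) (h : IsZMTriple m n r) : (ZMod m)ˣ :=
  (ZMod.unitOfCoprime r (coprime_of_isZMTriple hn h))⁻¹

theorem ratio_pow (hn : n ≠ 0) (h : IsZMTriple m n r) : ratio hn h ^ n = 1 := by
  rw [ratio, inv_pow, inv_eq_one]
  ext
  have := (ZMod.natCast_eq_natCast_iff _ _ _).2 h.pow_modEq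
  push_cast at this ⊢
  simpa using this

theorem natCast_mul_ratio (hn : n ≠ 0) (h : IsZMTriple m n r) : (r : ZMod m) * ratio hn h = 1 :=
  (ZMod.unitOfCoprime r (coprime_of_isZMTriple hn h)).mul_inv

theorem isUnit_ratio_sub_one (hn : n ≠ 0) (h : IsZMTriple m n r) :
    IsUnit ((ratio hn h : ZMod m) - 1) := by
  obtain ⟨x, y, hxy⟩ := Int.isCoprime_iff_gcd_eq_one.2 h.coprime_sub_one
  have hxy' := congrArg (Int.cast : ℤ → ZMod m) hxy
  push_cast at hxy'
  rw [CharP.cast_eq_zero, mul_zero, zero_add] at hxy'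
  have hr := natCast_mul_ratio hn h
  -- For `ρ` the inverse of `r`, `ρ - 1 = -ρ (r - 1)`, and `y` inverts `r - 1` by Bézout.
  refine IsUnit.of_mul_eq_one (-(r * y : ZMod m)) ?_
  linear_combination hxy' - (y : ZMod m) * hr

/-- The translations of `ZMod m`. -/
def translationHom (m : ℕ) : Multiplicative (ZMod m) →* Equiv.Perm (ZMod m) where
  toFun x := Equiv.addLeft x.toAdd
  map_one' := by ext x; simp
  map_mul' x y := by ext z; simp

theorem translationHom_apply (x : Multiplicative (ZMod m)) (y : ZMod m) :
    translationHom m x y = x.toAdd + y := rfl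

/-- The action on `ZMod m` by affine maps. -/
def affineHom (hn : n ≠ 0) (h : IsZMTriple m n r) : ZM m n r →* Equiv.Perm (ZMod m) :=
  -- If `b` multiplies by `ρ`, then `b⁻¹ a b` translates by `ρ⁻¹`; matching this with `a ^ r` forces
  -- `ρ = r⁻¹`.
  lift (translationHom m (.ofAdd 1)) (MulAction.toPermHom (ZMod m)ˣ (ZMod m) (ratio hn h))
    (by rw [← map_pow, ← ofAdd_nsmul]; simp)
    (by rw [← map_pow, ratio_pow, map_one])
    (by
      ext x
      have := natCast_mul_ratio hn h
      rw [← map_pow, ← ofAdd_nsmul, mul_assoc, ← map_inv]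
      simp only [Equiv.Perm.mul_apply, MulAction.toPermHom_apply, MulAction.toPerm_apply,
        translationHom_apply, toAdd_ofAdd, Units.smul_def, smul_eq_mul, nsmul_eq_mul, mul_one, mul_add]
      rw [← mul_assoc, Units.inv_mul, one_mul]
      simp [ratio])

/-- The linear part of the action. -/
def multHom (hn : n ≠ 0) (h : IsZMTriple m n r) : ZM m n r →* (ZMod m)ˣ :=
  lift 1 (ratio hn h) (one_pow _) (ratio_pow hn h) (by simp)

variable (m n r) in
/-- The projection onto the complement generated by `b`. -/
def projHom : ZM m n r →* Multiplicative (ZMod n) :=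
  lift 1 (Multiplicative.ofAdd 1) (one_pow _) (by rw [← ofAdd_nsmul]; simp) (by simp)

/-- The elements acting affinely with the prescribed ratio form a subgroup, so checking the two
generators suffices. -/
theorem affineHom_sub (hn : n ≠ 0) (h : IsZMTriple m n r) (g : ZM m n r) (x y : ZMod m) :
    affineHom hn h g x - affineHom hn h g y = multHom hn h g * (x - y) := by
  let H : Subgroup (ZM m n r) :=
    { carrier := {g | ∀ x y, affineHom hn h g x - affineHom hn h g y = multHom hn h g * (x - y)}
      one_mem' := by simp
      mul_mem' := fun {a b} ha hb x y => by
        simp only [map_mul, Equiv.Perm.mul_apply, Units.val_mul]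
        rw [ha, hb, mul_assoc]
      inv_mem' := fun {a} ha x y => by
        have := ha ((affineHom hn h a)⁻¹ x) ((affineHom hn h a)⁻¹ y)
        rw [← Equiv.Perm.mul_apply, ← Equiv.Perm.mul_apply, mul_inv_cancel, Equiv.Perm.one_apply,
          Equiv.Perm.one_apply] at this
        rw [this, map_inv, map_inv, ← mul_assoc, Units.inv_mul, one_mul] }
  refine mem_of_genA_of_genB H ?_ ?_ g x y
  · intro x y
    simp [affineHom, multHom, translationHom_apply]
  · intro x y
    simp [affineHom, multHom, Units.smul_def, mul_sub]

theorem affineHom_zpow_mul_zpow (hn : n ≠ 0) (h : IsZMTriple m n r) (i j : ℤ) :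
    affineHom hn h (genA m n r ^ i * genB m n r ^ j) 0 = i := by
  rw [map_mul, map_zpow, map_zpow, affineHom, lift_genA, lift_genB, ← map_zpow (translationHom m),
    ← map_zpow (MulAction.toPermHom _ _),
    ← ofAdd_zsmul, Equiv.Perm.mul_apply, translationHom_apply]
  simp

theorem projHom_zpow_mul_zpow (i j : ℤ) :
    projHom m n r (genA m n r ^ i * genB m n r ^ j) = Multiplicative.ofAdd (j : ZMod n) := by
  simp [projHom, ← ofAdd_zsmul]

theorem multHom_zpow_mul_zpow (hn : n ≠ 0) (h : IsZMTriple m n r) (i j : ℤ) :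
    multHom hn h (genA m n r ^ i * genB m n r ^ j) = ratio hn h ^ j := by
  simp [multHom]

/-- A ZM-group with `n` prime acts on `ZMod m` by affine maps. -/
def affineData (hn : n.Prime) (h : IsZMTriple m n r) : AffineData (ZM m n r) m n where
  trans g := affineHom hn.ne_zero h g 0
  mult := multHom hn.ne_zero h
  proj := projHom m n r
  trans_mul g k := by
    have := affineHom_sub hn.ne_zero h g (affineHom hn.ne_zero h k 0) 0
    rw [sub_zero] at this
    rw [map_mul, Equiv.Perm.mul_apply, ← this]
    ring
  bijective := by
    constructor
    -- In the normal form `a ^ i * b ^ j`, the action on `0` recovers `i` mod `m` and the projection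
    -- recovers `j` mod `n`, so the presentation collapses no further.
    · intro g k hgk
      obtain ⟨i, j, rfl⟩ := exists_eq_zpow_mul_zpow hn.ne_zero h g
      obtain ⟨i', j', rfl⟩ := exists_eq_zpow_mul_zpow hn.ne_zero h k
      simp only [affineHom_zpow_mul_zpow, projHom_zpow_mul_zpow, Prod.mk.injEq] at hgk
      rw [genA_zpow_congr hgk.1, genB_zpow_congr (Multiplicative.ofAdd.injective hgk.2)]
    · rintro ⟨x, y⟩
      obtain ⟨i, rfl⟩ := ZMod.intCast_surjective x
      obtain ⟨j, hj⟩ := ZMod.intCast_surjective y.toAdd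
      refine ⟨genA m n r ^ i * genB m n r ^ j, Prod.ext (affineHom_zpow_mul_zpow _ _ _ _) ?_⟩
      simp only [projHom_zpow_mul_zpow, hj, ofAdd_toAdd]
  mult_eq_one g hg := by
    obtain ⟨i, j, rfl⟩ := exists_eq_zpow_mul_zpow hn.ne_zero h g
    rw [projHom_zpow_mul_zpow, ofAdd_eq_one, ZMod.intCast_zmod_eq_zero_iff_dvd] at hg
    obtain ⟨k, rfl⟩ := hg
    rw [multHom_zpow_mul_zpow, zpow_mul, zpow_natCast, ratio_pow, one_zpow]
  isUnit_mult_sub_one g hg := by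
    obtain ⟨i, j, rfl⟩ := exists_eq_zpow_mul_zpow hn.ne_zero h g
    rw [projHom_zpow_mul_zpow, Ne, ofAdd_eq_one, ZMod.intCast_zmod_eq_zero_iff_dvd] at hg
    rw [multHom_zpow_mul_zpow]
    have : Fact n.Prime := ⟨hn⟩
    have hj : (j : ZMod n) ≠ 0 := by rwa [Ne, ZMod.intCast_zmod_eq_zero_iff_dvd]
    -- With `j'` an inverse of `j` mod the prime `n`, `(ρ ^ j) ^ j' = ρ`, so `ρ ^ j - 1` divides the
    -- unit `ρ - 1`.
    have hk : (n : ℤ) ∣ j * ((j : ZMod n)⁻¹.val : ℕ) - 1 := by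
      rw [← ZMod.intCast_zmod_eq_zero_iff_dvd]
      push_cast
      rw [ZMod.natCast_zmod_val, mul_inv_cancel₀ hj, sub_self]
    obtain ⟨l, hl⟩ := hk
    have hpow : (ratio hn.ne_zero h ^ j) ^ (j : ZMod n)⁻¹.val = ratio hn.ne_zero h := by
      rw [← zpow_natCast, ← zpow_mul, sub_eq_iff_eq_add.1 hl, zpow_add, zpow_mul, zpow_natCast,
        ratio_pow, one_zpow, one_mul, zpow_one]
    refine isUnit_of_dvd_unit ?_ (isUnit_ratio_sub_one hn.ne_zero h)
    have := sub_dvd_pow_sub_pow ((ratio hn.ne_zero h ^ j : (ZMod m)ˣ) : ZMod m) 1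
      (j : ZMod n)⁻¹.val
    rwa [one_pow, ← Units.val_pow_eq_pow_val, hpow] at this

theorem ne_zero_of_isZMTriple (hn : n.Prime) (h : IsZMTriple m n r) : m ≠ 0 := by
  rintro rfl
  exact hn.one_lt.ne' (by simpa using h.coprime)

/-! ### The dihedral case and the conclusion. -/

theorem nonempty_mulEquiv_dihedralGroup {m : ℕ} (hm : m ≠ 0) (h : IsZMTriple m 2 (m - 1)) :
    Nonempty (ZM m 2 (m - 1) ≃* DihedralGroup m) := by
  have : NeZero m := ⟨hm⟩
  let f : ZM m 2 (m - 1) →* DihedralGroup m :=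
    lift (DihedralGroup.r 1) (DihedralGroup.sr 0) (by simp)
      (by rw [pow_two, DihedralGroup.sr_mul_self])
      (by
        rw [DihedralGroup.r_one_pow]
        simp [Nat.cast_sub (Nat.one_le_iff_ne_zero.2 hm)])
  have hf : Function.Surjective f := by
    have ha : f (genA _ _ _) = DihedralGroup.r 1 := lift_genA _ _ _
    have hb : f (genB _ _ _) = DihedralGroup.sr 0 := lift_genB _ _ _
    rintro (i | i)
    · exact ⟨genA _ _ _ ^ i.val, by simp [ha]⟩
    · exact ⟨genB _ _ _ * genA _ _ _ ^ i.val, by simp [ha, hb]⟩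
  -- The affine coordinates give order `2m`, so the surjection `f` is an isomorphism.
  have hb := (affineData Nat.prime_two h).bijective
  have hcard : Nat.card (ZM m 2 (m - 1)) = Nat.card (DihedralGroup m) := by
    rw [Nat.card_congr (Equiv.ofBijective _ hb), Nat.card_prod, DihedralGroup.nat_card,
      Nat.card_zmod, Nat.card_congr Multiplicative.toAdd, Nat.card_zmod, mul_comm]
  have : Finite (ZM m 2 (m - 1)) := Finite.of_injective _ hb.1
  exact ⟨MulEquiv.ofBijective f ((Nat.bijective_iff_surjective_and_card f).2 ⟨hf, hcard⟩)⟩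

theorem sd_eq (hn : n.Prime) (h : IsZMTriple m n r) : sd (ZM m n r) = sdValue m :=
  (affineData hn h).sd_eq hn (ne_zero_of_isZMTriple hn h)

theorem csd_eq (hn : n.Prime) (h : IsZMTriple m n r) : csd (ZM m n r) = csdValue m :=
  (affineData hn h).csd_eq hn (ne_zero_of_isZMTriple hn h)

end ZM

theorem proposition4p5 :
    (∀ m n r : ℕ, IsZMTriple m n r → n.Prime →
      sd (ZM m n r) = sdValue m ∧ csd (ZM m n r) = csdValue m) ∧
    (∀ m n r n' r' : ℕ, IsZMTriple m n r → n.Prime → IsZMTriple m n' r' → n'.Prime →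
      sd (ZM m n r) = sd (ZM m n' r') ∧ csd (ZM m n r) = csd (ZM m n' r')) ∧
    (∀ m : ℕ, Odd m → 3 ≤ m →
      IsZMTriple m 2 (m - 1) ∧
      Nonempty (ZM m 2 (m - 1) ≃* DihedralGroup m) ∧
      sd (ZM m 2 (m - 1)) = sd (DihedralGroup m) ∧
      csd (ZM m 2 (m - 1)) = csd (DihedralGroup m) ∧
      sd (DihedralGroup m) = sdValue m ∧
      csd (DihedralGroup m) = csdValue m) := by
  refine ⟨fun m n r h hn => ⟨ZM.sd_eq hn h, ZM.csd_eq hn h⟩, fun m n r n' r' h hn h' hn' =>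
    ⟨(ZM.sd_eq hn h).trans (ZM.sd_eq hn' h').symm, (ZM.csd_eq hn h).trans (ZM.csd_eq hn' h').symm⟩,
    fun m hm h3 => ?_⟩
  have h := IsZMTriple.of_odd hm h3
  obtain ⟨e⟩ := ZM.nonempty_mulEquiv_dihedralGroup (by omega) h
  exact ⟨h, ⟨e⟩, sd_congr e, csd_congr e, (sd_congr e).symm.trans (ZM.sd_eq Nat.prime_two h),
    (csd_congr e).symm.trans (ZM.csd_eq Nat.prime_two h)⟩
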